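/- Let $n,m,l\in\mathbb N$, write $\mathbb M_n$ for the algebra of $n\times n$ complex matrices and $\mathbb P_n$ for the set of positive definite matrices in $\mathbb M_n$. Let $\Phi:\mathbb M_n\to\mathbb M_l$ and $\Psi:\mathbb M_m\to\mathbb M_l$ be completely positive linear maps that are strictly positive, i.e. $\Phi(\mathbb P_n)\subseteq\mathbb P_l$ and $\Psi(\mathbb P_m)\subseteq\mathbb P_l$. Let $-1\le p\le 0$, and let $f$ be a real function on $(0,\infty)$ that is non-decreasing and concave and satisfies $\lim_{x\to\infty}f(x)/x=0$. Assume that $x\mapsto f(x^{2+p})$ is convex on $(0,\infty)$. Then the function $$(A,B)\in\mathbb P_n\times\mathbb P_m\longmapsto \mathrm{Tr}\, f\bigl(\Phi(A^p)^{1/2}\,\Psi(B^2)\,\Phi(A^p)^{1/2}\bigr)$$ is jointly convex. -/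

import Mathlib

open Filter Topology Set
open scoped ComplexOrder MatrixOrder Matrix.Norms.L2Operator CStarAlgebra

/-- A linear map between matrix algebras is strictly positive if it maps positive definite
matrices to positive definite matrices. -/
def StrictlyPositiveMap {n l : ℕ}
    (Φ : Matrix (Fin n) (Fin n) ℂ →ₗ[ℂ] Matrix (Fin l) (Fin l) ℂ) : Prop :=
  ∀ A : Matrix (Fin n) (Fin n) ℂ, A.PosDef → (Φ A).PosDef

/-- The trace function of Lieb type `Tr f(Φ(A^p)^{1/2} Ψ(B^q) Φ(A^p)^{1/2})`. Real powers and `f`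
are applied by functional calculus. For positive definite `A`, `B` and strictly positive `Φ`, `Ψ`
the argument of `f` is positive definite, so only the values of `f` on `(0, ∞)` matter and the
trace is a real number. -/
noncomputable def liebTrace {n m l : ℕ} (f : ℝ → ℝ) (p q : ℝ)
    (Φ : Matrix (Fin n) (Fin n) ℂ →ₗ[ℂ] Matrix (Fin l) (Fin l) ℂ)
    (Ψ : Matrix (Fin m) (Fin m) ℂ →ₗ[ℂ] Matrix (Fin l) (Fin l) ℂ)
    (A : Matrix (Fin n) (Fin n) ℂ) (B : Matrix (Fin m) (Fin m) ℂ) : ℝ :=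
  (cfc f (Φ (A ^ p) ^ (1 / 2 : ℝ) * Ψ (B ^ q) * Φ (A ^ p) ^ (1 / 2 : ℝ))).trace.re

/-!
Write `β = 1 + p` and `X = Φ(A^p)^{1/2} Ψ(B²) Φ(A^p)^{1/2}`. The idea is to write `Tr f(X)` as an
infimum, over an auxiliary positive definite matrix `U`, of a quantity that is jointly convex in
`(A, B, U)`; a partial infimum of a jointly convex function is convex.

If `p = -1` then `f` is convex, monotone and sublinear, hence constant. Otherwise `0 < β ≤ 1`.

* Scalar variational principle (`exists_convex_variational`): concavity and sublinearity give
  `f(s) = inf_u (s u^{-β} + k(u))` with `k(u) = sup_y (f(y) - y u^{-β})`. Substituting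
  `y = (v u)^{1+β}` gives `k(u) = sup_v (f((v u)^{1+β}) - v^{1+β} u)`, so convexity of
  `x ↦ f(x^{1+β})` makes `k` convex. Klein's inequality (`klein_inequality`) lifts this to
  `Tr f(S) = inf_U (Tr S U^{-β} + Tr k(U))`.
* Linearization in `B`: by Choi's theorem (`CompletelyPositiveMap.exists_kraus`) `Ψ(B²) = YᴴY`,
  where the tall matrix `Y` is linear in `B`. The matrix `X` has the same eigenvalues as
  `S = Y Φ(A^p) Yᴴ` apart from zeros (`re_trace_cfc_rpow_half_conj`), which are accounted for by
  extending `f` to `0` by its limit. With Kraus operators `Vκ` of `Φ`, `S` is the sum of the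
  matrices `(Vκ Yᴴ)ᴴ A^p (Vκ Yᴴ)`.
* Joint convexity (`variational_objective_convex`): `Tr k(U)` is convex (`trace_cfc_convex`), and
  `(A, U, K) ↦ Tr Kᴴ A^{β-1} K U^{-β}` is jointly convex (`lieb_joint_convex`). The latter holds
  because `x^{β-1} y^{-β}` is an average of the functions `(x + t y)⁻¹`, and the quadratic form
  `⟨K, (Z ↦ A Z + t Z U)⁻¹ K⟩` is the supremum over `Z` of expressions affine in `(A, U, K)`.
-/

/-! ### Traces as double sums over two spectra -/

section SpectralWeights

variable {n N : Type*} [Fintype n] [DecidableEq n] [Fintype N] [DecidableEq N]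

/-- For Hermitian `A`, `U` with chosen orthonormal eigenbases `eᵢ`, `gⱼ`, the numbers
`|⟨eᵢ, K gⱼ⟩|²`. -/
noncomputable def specWeight {A : Matrix n n ℂ} {U : Matrix N N ℂ} (hA : A.IsHermitian)
    (hU : U.IsHermitian) (K : Matrix n N ℂ) (i : n) (j : N) : ℝ :=
  Complex.normSq
    ((star (hA.eigenvectorUnitary : Matrix n n ℂ) * K * (hU.eigenvectorUnitary : Matrix N N ℂ)) i j)

lemma specWeight_nonneg {A : Matrix n n ℂ} {U : Matrix N N ℂ} (hA : A.IsHermitian)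
    (hU : U.IsHermitian) (K : Matrix n N ℂ) (i : n) (j : N) : 0 ≤ specWeight hA hU K i j :=
  Complex.normSq_nonneg _

lemma cfc_eq_eigenvectorUnitary {A : Matrix n n ℂ} (hA : A.IsHermitian) (φ : ℝ → ℝ) :
    cfc φ A = (hA.eigenvectorUnitary : Matrix n n ℂ) *
      Matrix.diagonal (fun i => (φ (hA.eigenvalues i) : ℂ)) *
      star (hA.eigenvectorUnitary : Matrix n n ℂ) := by
  rw [hA.cfc_eq, Matrix.IsHermitian.cfc, Unitary.conjStarAlgAut_apply]
  rfl

lemma re_trace_diagonal_mul (M : Matrix n N ℂ) (x : n → ℝ) (y : N → ℝ) :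
    (M.conjTranspose * Matrix.diagonal (fun i => (x i : ℂ)) * M *
      Matrix.diagonal (fun j => (y j : ℂ))).trace.re =
      ∑ i, ∑ j, x i * y j * Complex.normSq (M i j) := by
  rw [Finset.sum_comm]
  simp only [Matrix.trace, Matrix.diag, Matrix.mul_diagonal, Complex.re_sum]
  refine Finset.sum_congr rfl fun j _ => ?_
  rw [Matrix.mul_apply, Finset.sum_mul, Complex.re_sum]
  refine Finset.sum_congr rfl fun i _ => ?_
  rw [Matrix.mul_diagonal, Matrix.conjTranspose_apply]
  simp [Complex.normSq_apply]
  ring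

/-- A trace of the form `Tr Kᴴ φ(A) K ψ(U)` is a double sum over the two spectra. -/
lemma re_trace_cfc_mul_cfc {A : Matrix n n ℂ} {U : Matrix N N ℂ} (hA : A.IsHermitian)
    (hU : U.IsHermitian) (K : Matrix n N ℂ) (φ ψ : ℝ → ℝ) :
    (K.conjTranspose * cfc φ A * K * cfc ψ U).trace.re =
      ∑ i, ∑ j, φ (hA.eigenvalues i) * ψ (hU.eigenvalues j) * specWeight hA hU K i j := by
  unfold specWeight
  rw [← re_trace_diagonal_mul, cfc_eq_eigenvectorUnitary hA, cfc_eq_eigenvectorUnitary hU]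
  congr 1
  simp only [Matrix.conjTranspose_mul, ← Matrix.star_eq_conjTranspose (M := (star
    (hA.eigenvectorUnitary : Matrix n n ℂ))), ← Matrix.star_eq_conjTranspose (M :=
    (hU.eigenvectorUnitary : Matrix N N ℂ)), star_star]
  simp only [← Matrix.mul_assoc]
  rw [Matrix.trace_mul_comm]
  simp only [Matrix.mul_assoc]

lemma cfc_one_eq {A : Matrix n n ℂ} (hA : A.IsHermitian) : cfc (fun _ : ℝ => (1 : ℝ)) A = 1 := by
  rw [cfc_eq_eigenvectorUnitary hA]
  simp

lemma cfc_id_eq {A : Matrix n n ℂ} (hA : A.IsHermitian) : cfc (fun x : ℝ => x) A = A :=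
  cfc_id' ℝ A hA

/-! ### Lieb's joint convexity theorem -/

/-- The real-affine expression `2 Re ⟨Z, K⟩ - ⟨Z, s A Z + t Z U⟩`, for the Hilbert–Schmidt inner
product. Its supremum over `Z` is the quadratic form at `K` of the inverse of
`Z ↦ s A Z + t Z U`. -/
noncomputable def sylvesterAffine (s t : ℝ) (Z : Matrix n N ℂ) (A : Matrix n n ℂ)
    (U : Matrix N N ℂ) (K : Matrix n N ℂ) : ℝ :=
  2 * (Z.conjTranspose * K).trace.re - s * (Z.conjTranspose * A * Z).trace.re
    - t * (Z.conjTranspose * Z * U).trace.re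

/-- In the eigenbases of `A` and `U` the superoperator `Z ↦ s A Z + t Z U` is diagonal. -/
lemma sylvesterAffine_eq {A : Matrix n n ℂ} {U : Matrix N N ℂ} (hA : A.IsHermitian)
    (hU : U.IsHermitian) (s t : ℝ) (M : Matrix n N ℂ) (K : Matrix n N ℂ) :
    sylvesterAffine s t ((hA.eigenvectorUnitary : Matrix n n ℂ) * M *
      star (hU.eigenvectorUnitary : Matrix N N ℂ)) A U K =
    ∑ i, ∑ j, (2 * (star (M i j) * ((star (hA.eigenvectorUnitary : Matrix n n ℂ) * K *
      (hU.eigenvectorUnitary : Matrix N N ℂ)) i j)).re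
      - (s * hA.eigenvalues i + t * hU.eigenvalues j) * Complex.normSq (M i j)) := by
  set V := (hA.eigenvectorUnitary : Matrix n n ℂ) with hV
  set W := (hU.eigenvectorUnitary : Matrix N N ℂ) with hW
  have hVV : star V * V = 1 := by simp [hV]
  have hWW : star W * W = 1 := by simp [hW]
  set Z := V * M * star W with hZ
  have hZM : star V * Z * W = M := by
    rw [hZ]
    calc star V * (V * M * star W) * W = (star V * V) * M * (star W * W) := by
          simp only [Matrix.mul_assoc]
      _ = M := by simp [hVV, hWW]
  have hw : ∀ i j, specWeight hA hU Z i j = Complex.normSq (M i j) := by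
    intro i j
    rw [specWeight, ← hV, ← hW, hZM]
  have h1 := re_trace_cfc_mul_cfc hA hU Z (fun x => x) (fun _ => 1)
  rw [cfc_id_eq hA, cfc_one_eq hU, Matrix.mul_one] at h1
  have h2 := re_trace_cfc_mul_cfc hA hU Z (fun _ => 1) (fun x => x)
  rw [cfc_one_eq hA, cfc_id_eq hU, Matrix.mul_one] at h2
  have h3 : (Z.conjTranspose * K).trace = ∑ i, ∑ j, star (M i j) * (star V * K * W) i j := by
    have : (Z.conjTranspose * K).trace = (M.conjTranspose * (star V * K * W)).trace := by
      rw [hZ, Matrix.conjTranspose_mul, Matrix.conjTranspose_mul,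
        ← Matrix.star_eq_conjTranspose (M := star W), ← Matrix.star_eq_conjTranspose (M := V),
        star_star, Matrix.mul_assoc, Matrix.trace_mul_comm]
      simp only [Matrix.mul_assoc]
    rw [this, Finset.sum_comm]
    simp [Matrix.trace, Matrix.mul_apply]
  rw [sylvesterAffine, h1, h2, h3]
  simp only [hw, Complex.re_sum, Finset.mul_sum, ← Finset.sum_sub_distrib]
  refine Finset.sum_congr rfl fun i _ => Finset.sum_congr rfl fun j _ => ?_
  ring

/-- Completing the square entrywise bounds the affine expressions by the resolvent sum. -/
lemma sylvesterAffine_le {A : Matrix n n ℂ} {U : Matrix N N ℂ} (hA : A.PosDef)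
    (hU : U.PosDef) {s t : ℝ} (hs : 0 ≤ s) (ht : 0 < t) (Z : Matrix n N ℂ) (K : Matrix n N ℂ) :
    sylvesterAffine s t Z A U K ≤ ∑ i, ∑ j,
      (s * hA.1.eigenvalues i + t * hU.1.eigenvalues j)⁻¹ * specWeight hA.1 hU.1 K i j := by
  have hZ : Z = (hA.1.eigenvectorUnitary : Matrix n n ℂ) *
      (star (hA.1.eigenvectorUnitary : Matrix n n ℂ) * Z *
        (hU.1.eigenvectorUnitary : Matrix N N ℂ)) *
      star (hU.1.eigenvectorUnitary : Matrix N N ℂ) := by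
    have h1 : (hA.1.eigenvectorUnitary : Matrix n n ℂ) *
      star (hA.1.eigenvectorUnitary : Matrix n n ℂ) = 1 := by simp
    have h2 : (hU.1.eigenvectorUnitary : Matrix N N ℂ) *
      star (hU.1.eigenvectorUnitary : Matrix N N ℂ) = 1 := by simp
    calc Z = ((hA.1.eigenvectorUnitary : Matrix n n ℂ) *
      star (hA.1.eigenvectorUnitary : Matrix n n ℂ)) * Z *
       ((hU.1.eigenvectorUnitary : Matrix N N ℂ) *
      star (hU.1.eigenvectorUnitary : Matrix N N ℂ)) := by rw [h1, h2]; simp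
      _ = _ := by simp only [Matrix.mul_assoc]
  rw [hZ, sylvesterAffine_eq]
  refine Finset.sum_le_sum fun i _ => Finset.sum_le_sum fun j _ => ?_
  rw [specWeight]
  generalize (star (hA.1.eigenvectorUnitary : Matrix n n ℂ) * Z *
        (hU.1.eigenvectorUnitary : Matrix N N ℂ)) i j = z
  generalize (star (hA.1.eigenvectorUnitary : Matrix n n ℂ) * K *
        (hU.1.eigenvectorUnitary : Matrix N N ℂ)) i j = k
  have hd : 0 < s * hA.1.eigenvalues i + t * hU.1.eigenvalues j :=
    add_pos_of_nonneg_of_pos (mul_nonneg hs (hA.eigenvalues_pos i).le)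
      (mul_pos ht (hU.eigenvalues_pos j))
  generalize s * hA.1.eigenvalues i + t * hU.1.eigenvalues j = d at hd
  rw [inv_mul_eq_div, le_div_iff₀ hd]
  simp only [RCLike.star_def, Complex.mul_re, Complex.conj_re, Complex.conj_im, Complex.normSq_apply]
  nlinarith [sq_nonneg (d * z.re - k.re), sq_nonneg (d * z.im - k.im)]

/-- The bound is attained at the solution `Z` of the Sylvester equation `s A Z + t Z U = K`. -/
lemma exists_sylvesterAffine_eq {A : Matrix n n ℂ} {U : Matrix N N ℂ} (hA : A.PosDef)
    (hU : U.PosDef) {s t : ℝ} (hs : 0 ≤ s) (ht : 0 < t) (K : Matrix n N ℂ) :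
    ∃ Z, sylvesterAffine s t Z A U K = ∑ i, ∑ j,
      (s * hA.1.eigenvalues i + t * hU.1.eigenvalues j)⁻¹ * specWeight hA.1 hU.1 K i j := by
  refine ⟨(hA.1.eigenvectorUnitary : Matrix n n ℂ) *
      (Matrix.of fun i j => ((s * hA.1.eigenvalues i + t * hU.1.eigenvalues j : ℝ) : ℂ)⁻¹ *
        (star (hA.1.eigenvectorUnitary : Matrix n n ℂ) * K *
        (hU.1.eigenvectorUnitary : Matrix N N ℂ)) i j) *
      star (hU.1.eigenvectorUnitary : Matrix N N ℂ), ?_⟩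
  rw [sylvesterAffine_eq]
  refine Finset.sum_congr rfl fun i _ => Finset.sum_congr rfl fun j _ => ?_
  rw [specWeight, Matrix.of_apply]
  generalize (star (hA.1.eigenvectorUnitary : Matrix n n ℂ) * K *
        (hU.1.eigenvectorUnitary : Matrix N N ℂ)) i j = k
  have hd : 0 < s * hA.1.eigenvalues i + t * hU.1.eigenvalues j :=
    add_pos_of_nonneg_of_pos (mul_nonneg hs (hA.eigenvalues_pos i).le)
      (mul_pos ht (hU.eigenvalues_pos j))
  generalize s * hA.1.eigenvalues i + t * hU.1.eigenvalues j = d at hd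
  rw [← Complex.ofReal_inv, Complex.normSq_mul, Complex.normSq_ofReal]
  simp only [RCLike.star_def, Complex.mul_re, Complex.conj_re, Complex.conj_im, map_mul,
    Complex.conj_ofReal, Complex.mul_im, Complex.ofReal_re, Complex.ofReal_im, Complex.normSq_apply]
  field_simp
  ring

omit [DecidableEq n] [DecidableEq N] in
lemma sylvesterAffine_combo (s t a b : ℝ) (Z : Matrix n N ℂ) (A₁ A₂ : Matrix n n ℂ)
    (U₁ U₂ : Matrix N N ℂ) (K₁ K₂ : Matrix n N ℂ) :
    sylvesterAffine s t Z (a • A₁ + b • A₂) (a • U₁ + b • U₂) (a • K₁ + b • K₂) =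
      a * sylvesterAffine s t Z A₁ U₁ K₁ + b * sylvesterAffine s t Z A₂ U₂ K₂ := by
  simp only [sylvesterAffine, Matrix.mul_add, Matrix.add_mul, Matrix.mul_smul, Matrix.smul_mul,
    Matrix.trace_add, Matrix.trace_smul, Complex.add_re, Complex.smul_re, smul_eq_mul]
  ring

omit [Fintype n] [DecidableEq n] in
lemma posDef_combo {A₁ A₂ : Matrix n n ℂ} (h₁ : A₁.PosDef) (h₂ : A₂.PosDef) {a b : ℝ}
    (ha : 0 ≤ a) (hb : 0 ≤ b) (hab : a + b = 1) : (a • A₁ + b • A₂).PosDef := by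
  rcases ha.eq_or_lt with rfl | ha
  · obtain rfl : b = 1 := by linarith
    simpa using h₂
  · exact (h₁.smul ha).add_posSemidef (h₂.posSemidef.smul hb)

/-- The resolvent sum is a supremum of functions affine in `(A, U, K)`, hence jointly convex. -/
lemma resolvent_sum_convex {A₁ A₂ : Matrix n n ℂ} {U₁ U₂ : Matrix N N ℂ} {K₁ K₂ : Matrix n N ℂ}
    {a b : ℝ} (hA₁ : A₁.PosDef) (hA₂ : A₂.PosDef) (hU₁ : U₁.PosDef) (hU₂ : U₂.PosDef)
    (hA : (a • A₁ + b • A₂).PosDef) (hU : (a • U₁ + b • U₂).PosDef)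
    (ha : 0 ≤ a) (hb : 0 ≤ b) {s t : ℝ} (hs : 0 ≤ s) (ht : 0 < t) :
    ∑ i, ∑ j, (s * hA.1.eigenvalues i + t * hU.1.eigenvalues j)⁻¹ *
        specWeight hA.1 hU.1 (a • K₁ + b • K₂) i j ≤
      a * (∑ i, ∑ j, (s * hA₁.1.eigenvalues i + t * hU₁.1.eigenvalues j)⁻¹ *
        specWeight hA₁.1 hU₁.1 K₁ i j) +
      b * (∑ i, ∑ j, (s * hA₂.1.eigenvalues i + t * hU₂.1.eigenvalues j)⁻¹ *
        specWeight hA₂.1 hU₂.1 K₂ i j) := by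
  obtain ⟨Z, hZ⟩ := exists_sylvesterAffine_eq hA hU hs ht (a • K₁ + b • K₂)
  rw [← hZ, sylvesterAffine_combo]
  exact add_le_add (mul_le_mul_of_nonneg_left (sylvesterAffine_le hA₁ hU₁ hs ht Z K₁) ha)
    (mul_le_mul_of_nonneg_left (sylvesterAffine_le hA₂ hU₂ hs ht Z K₂) hb)

/-- Up to the measure, `x ^ (β - 1) * y ^ (-β)` is an average of the resolvents
`(x + t * y)⁻¹`. -/
lemma exists_measure_rpow_mul_rpow {β : ℝ} (hβ : β ∈ Ioo 0 1) :
    ∃ μ : MeasureTheory.Measure ℝ, ∃ w : ℝ → ℝ, (∀ t ∈ Ioi (0 : ℝ), 0 ≤ w t) ∧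
      ∀ x > 0, ∀ y > 0,
        MeasureTheory.IntegrableOn (fun t => w t * (1 * x + t * y)⁻¹) (Ioi 0) μ ∧
        x ^ (β - 1) * y ^ (-β) = ∫ t in Ioi 0, w t * (1 * x + t * y)⁻¹ ∂μ := by
  obtain ⟨μ, hμ⟩ := Real.exists_measure_rpow_eq_integral_rpowIntegrand₀₁ hβ
  refine ⟨μ, fun t => t ^ (β - 1), fun t ht => Real.rpow_nonneg (le_of_lt ht) _, ?_⟩
  intro x hx y hy
  obtain ⟨h1, h2⟩ := hμ (x / y) (div_pos hx hy).le
  have key : ∀ t ∈ Ioi (0 : ℝ), t ^ (β - 1) * (1 * x + t * y)⁻¹ =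
      Real.rpowIntegrand₀₁ β t (x / y) * x⁻¹ := by
    intro t ht
    have ht : 0 < t := ht
    rw [Real.rpowIntegrand₀₁_eq_pow_div hβ ht.le (div_pos hx hy).le]
    have : 0 < t * y + x := by positivity
    field_simp
    ring
  have h1' : MeasureTheory.IntegrableOn
      (fun t => Real.rpowIntegrand₀₁ β t (x / y) * x⁻¹) (Ioi 0) μ :=
    MeasureTheory.Integrable.mul_const h1 x⁻¹
  refine ⟨h1'.congr_fun (fun t ht => (key t ht).symm) measurableSet_Ioi, ?_⟩
  rw [MeasureTheory.setIntegral_congr_fun measurableSet_Ioi key, MeasureTheory.integral_mul_const,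
    ← h2, Real.div_rpow hx.le hy.le, Real.rpow_sub_one hx.ne', Real.rpow_neg hy.le]
  field_simp

/-- **Lieb's convexity theorem**: `(A, U, K) ↦ Tr Kᴴ A^{β-1} K U^{-β}` is jointly convex. -/
theorem lieb_joint_convex {β : ℝ} (hβ₀ : 0 < β) (hβ₁ : β ≤ 1)
    {A₁ A₂ : Matrix n n ℂ} {U₁ U₂ : Matrix N N ℂ} (K₁ K₂ : Matrix n N ℂ)
    {a b : ℝ} (hA₁ : A₁.PosDef) (hA₂ : A₂.PosDef) (hU₁ : U₁.PosDef) (hU₂ : U₂.PosDef)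
    (ha : 0 ≤ a) (hb : 0 ≤ b) (hab : a + b = 1) :
    ((a • K₁ + b • K₂).conjTranspose * cfc (fun x : ℝ => x ^ (β - 1)) (a • A₁ + b • A₂) *
        (a • K₁ + b • K₂) * cfc (fun x : ℝ => x ^ (-β)) (a • U₁ + b • U₂)).trace.re ≤
      a * (K₁.conjTranspose * cfc (fun x : ℝ => x ^ (β - 1)) A₁ * K₁ *
        cfc (fun x : ℝ => x ^ (-β)) U₁).trace.re +
      b * (K₂.conjTranspose * cfc (fun x : ℝ => x ^ (β - 1)) A₂ * K₂ *
        cfc (fun x : ℝ => x ^ (-β)) U₂).trace.re := by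
  have hA := posDef_combo hA₁ hA₂ ha hb hab
  have hU := posDef_combo hU₁ hU₂ ha hb hab
  rw [re_trace_cfc_mul_cfc hA.1 hU.1, re_trace_cfc_mul_cfc hA₁.1 hU₁.1,
    re_trace_cfc_mul_cfc hA₂.1 hU₂.1]
  rcases hβ₁.eq_or_lt with rfl | hβ₁
  · -- no integral is needed here: the first exponent vanishes
    have := resolvent_sum_convex (K₁ := K₁) (K₂ := K₂) hA₁ hA₂ hU₁ hU₂ hA hU ha hb
      (le_refl (0 : ℝ)) one_pos
    simpa [Real.rpow_neg_one] using this
  obtain ⟨μ, w, hw, hμ⟩ := exists_measure_rpow_mul_rpow ⟨hβ₀, hβ₁⟩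
  have key : ∀ {A : Matrix n n ℂ} {U : Matrix N N ℂ} (K : Matrix n N ℂ) (hA : A.PosDef)
      (hU : U.PosDef), MeasureTheory.IntegrableOn (fun t => w t * ∑ i, ∑ j,
        (1 * hA.1.eigenvalues i + t * hU.1.eigenvalues j)⁻¹ * specWeight hA.1 hU.1 K i j)
        (Ioi 0) μ ∧ ∑ i, ∑ j, hA.1.eigenvalues i ^ (β - 1) * hU.1.eigenvalues j ^ (-β) *
        specWeight hA.1 hU.1 K i j = ∫ t in Ioi 0, w t * ∑ i, ∑ j,
        (1 * hA.1.eigenvalues i + t * hU.1.eigenvalues j)⁻¹ * specWeight hA.1 hU.1 K i j ∂μ := by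
    intro A U K hA hU
    have hint : ∀ i j, MeasureTheory.IntegrableOn (fun t => w t *
        (1 * hA.1.eigenvalues i + t * hU.1.eigenvalues j)⁻¹ * specWeight hA.1 hU.1 K i j)
        (Ioi 0) μ := fun i j =>
      ((hμ _ (hA.eigenvalues_pos i) _ (hU.eigenvalues_pos j)).1).mul_const _
    simp only [Finset.mul_sum, ← mul_assoc]
    constructor
    · exact MeasureTheory.integrable_finsetSum _ fun i _ =>
        MeasureTheory.integrable_finsetSum _ fun j _ => hint i j
    · rw [MeasureTheory.integral_finsetSum _ fun i _ =>
        MeasureTheory.integrable_finsetSum _ fun j _ => hint i j]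
      refine Finset.sum_congr rfl fun i _ => ?_
      rw [MeasureTheory.integral_finsetSum _ fun j _ => hint i j]
      refine Finset.sum_congr rfl fun j _ => ?_
      rw [MeasureTheory.integral_mul_const,
        (hμ _ (hA.eigenvalues_pos i) _ (hU.eigenvalues_pos j)).2]
  obtain ⟨i₀, e₀⟩ := key (a • K₁ + b • K₂) hA hU
  obtain ⟨i₁, e₁⟩ := key K₁ hA₁ hU₁
  obtain ⟨i₂, e₂⟩ := key K₂ hA₂ hU₂
  rw [e₀, e₁, e₂, ← MeasureTheory.integral_const_mul, ← MeasureTheory.integral_const_mul,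
    ← MeasureTheory.integral_add (i₁.const_mul a) (i₂.const_mul b)]
  refine MeasureTheory.setIntegral_mono_on i₀ ((i₁.const_mul a).add (i₂.const_mul b))
    measurableSet_Ioi fun t ht => ?_
  have := mul_le_mul_of_nonneg_left (resolvent_sum_convex (K₁ := K₁) (K₂ := K₂) hA₁ hA₂ hU₁ hU₂
    hA hU ha hb zero_le_one ht) (hw t ht)
  refine this.trans (le_of_eq ?_)
  ring

end SpectralWeights

/-! ### Scalar convex analysis on `(0, ∞)` -/

lemma ConvexOn.exists_subgradient_Ioi {g : ℝ → ℝ} (hg : ConvexOn ℝ (Ioi 0) g) {x : ℝ}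
    (hx : 0 < x) : ∃ d : ℝ, ∀ y, 0 < y → g x + d * (y - x) ≤ g y := by
  have hxi : x ∈ interior (Ioi (0 : ℝ)) := by simpa using hx
  refine ⟨derivWithin g (Ioi x) x, fun y hy => ?_⟩
  rcases lt_trichotomy x y with h | rfl | h
  · have := hg.rightDeriv_le_slope_of_mem_interior hxi hy h
    rw [slope_def_field, le_div_iff₀ (by linarith)] at this
    linarith
  · simp
  · have := (hg.slope_le_leftDeriv_of_mem_interior hy hxi h).trans
      (hg.leftDeriv_le_rightDeriv_of_mem_interior hxi)
    rw [slope_def_field, div_le_iff₀ (by linarith)] at this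
    linarith

/-- A monotone convex function on `(0, ∞)` of sublinear growth is constant. -/
lemma ConvexOn.eq_of_monotoneOn_of_tendsto_div {f : ℝ → ℝ} (hconv : ConvexOn ℝ (Ioi 0) f)
    (hmono : MonotoneOn f (Ioi 0)) (hlim : Tendsto (fun x => f x / x) atTop (𝓝 0))
    {x y : ℝ} (hx : 0 < x) (hy : 0 < y) : f x = f y := by
  wlog hxy : x ≤ y generalizing x y
  · exact (this hy hx (le_of_not_ge hxy)).symm
  refine le_antisymm (hmono hx hy hxy) ?_
  obtain ⟨d, hd⟩ := hconv.exists_subgradient_Ioi hy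
  have hd0 : d ≤ 0 := by
    by_contra! h
    obtain ⟨z, hz1, hz2, hz3⟩ := ((hlim.eventually (gt_mem_nhds (half_pos h))).and
      ((eventually_gt_atTop 0).and (eventually_ge_atTop ((d * y - f y) / (d / 2))))).exists
    rw [div_lt_iff₀ hz2] at hz1
    rw [div_le_iff₀ (half_pos h)] at hz3
    have := hd z hz2
    linarith
  have := hd x hx
  nlinarith

/-- The scalar form of the variational principle: `f s` is the infimum over `u > 0` of
`s * u ^ (-β) + k u`, with a convex function `k`. The function `f₀` extends `f` to `0` by its
limit there, so that the principle also holds at `s = 0`. -/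
lemma exists_convex_variational {β : ℝ} (hβ : 0 < β) {f : ℝ → ℝ} (hmono : MonotoneOn f (Ioi 0))
    (hconc : ConcaveOn ℝ (Ioi 0) f) (hlim : Tendsto (fun x => f x / x) atTop (𝓝 0))
    (hconv : ConvexOn ℝ (Ioi 0) (fun x => f (x ^ (1 + β)))) :
    ∃ f₀ k : ℝ → ℝ, (∀ x, 0 < x → f₀ x = f x) ∧ ConvexOn ℝ (Ioi 0) k ∧
      (∀ s, 0 ≤ s → ∀ u, 0 < u → f₀ s ≤ s * u ^ (-β) + k u) ∧
      (∀ s, 0 ≤ s → ∀ ε, 0 < ε → ∃ u, 0 < u ∧ s * u ^ (-β) + k u ≤ f₀ s + ε) := by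
  have hsuper : ∀ x, 0 < x → ∃ d : ℝ, 0 ≤ d ∧ ∀ y, 0 < y → f y ≤ f x + d * (y - x) := by
    intro x hx
    obtain ⟨d, hd⟩ := hconc.neg.exists_subgradient_Ioi hx
    simp only [Pi.neg_apply] at hd
    refine ⟨-d, ?_, fun y hy => by linarith [hd y hy]⟩
    have h1 := hd (x + 1) (by linarith)
    have h2 := hmono (a := x) (b := x + 1) hx (show 0 < x + 1 by linarith) (by linarith)
    linarith
  have hbdd : ∀ τ, 0 < τ → BddAbove ((fun y => f y - y * τ) '' Ioi 0) := by
    intro τ hτ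
    obtain ⟨x, hx⟩ := eventually_atTop.1 (hlim.eventually (gt_mem_nhds hτ))
    refine ⟨|f (max x 1)|, ?_⟩
    rintro _ ⟨y, hy, rfl⟩
    have hy : 0 < y := hy
    have hyτ : 0 < y * τ := by positivity
    rcases le_total x y with h | h
    · have := (div_lt_iff₀ hy).1 (hx y h)
      have := abs_nonneg (f (max x 1))
      simp only
      linarith
    · have := hmono hy (show 0 < max x 1 by positivity) (h.trans (le_max_left _ _))
      have := le_abs_self (f (max x 1))
      simp only
      linarith
  have hbelow : BddBelow (f '' Ioi 0) := by
    -- a convex function on `(0, ∞)` lies above a supporting line, hence is bounded below near `0`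
    obtain ⟨d, hd⟩ := hconv.exists_subgradient_Ioi one_pos
    refine ⟨min (f 1) (f 1 - |d|), ?_⟩
    rintro _ ⟨y, hy, rfl⟩
    have hy : 0 < y := hy
    rcases le_total 1 y with h | h
    · exact (min_le_left _ _).trans (hmono (mem_Ioi.2 one_pos) hy h)
    · refine (min_le_right _ _).trans ?_
      have hz : 0 < y ^ (1 + β)⁻¹ := Real.rpow_pos_of_pos hy _
      have hz1 : y ^ (1 + β)⁻¹ ≤ 1 := Real.rpow_le_one hy.le h (by positivity)
      have := hd _ hz
      simp only [Real.one_rpow] at this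
      rw [← Real.rpow_mul hy.le, inv_mul_cancel₀ (by positivity), Real.rpow_one] at this
      have h3 : -|d| ≤ d * (y ^ (1 + β)⁻¹ - 1) := by
        have := abs_mul d (y ^ (1 + β)⁻¹ - 1)
        have h4 : |y ^ (1 + β)⁻¹ - 1| ≤ 1 := by rw [abs_le]; constructor <;> linarith
        have := neg_abs_le (d * (y ^ (1 + β)⁻¹ - 1))
        nlinarith [abs_nonneg d]
      linarith
  set c := sInf (f '' Ioi 0) with hc
  -- the Legendre-type transform of `f`
  set k : ℝ → ℝ := fun u => sSup ((fun y => f y - y * u ^ (-β)) '' Ioi 0) with hk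
  have hle : ∀ y, 0 < y → ∀ u, 0 < u → f y - y * u ^ (-β) ≤ k u := fun y hy u hu =>
    le_csSup (hbdd _ (Real.rpow_pos_of_pos hu _)) ⟨y, hy, rfl⟩
  have hkle : ∀ u M, (∀ y, 0 < y → f y - y * u ^ (-β) ≤ M) → k u ≤ M := by
    intro u M h
    refine csSup_le (nonempty_Ioi.image _) ?_
    rintro _ ⟨y, hy, rfl⟩
    exact h y hy
  refine ⟨fun x => if 0 < x then f x else c, k, fun x hx => if_pos hx, ?_, ?_, ?_⟩
  · -- after the substitution `y = (v * u) ^ (1 + β)` the supremum is over functions convex in `u`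
    refine ⟨convex_Ioi 0, fun u₁ hu₁ u₂ hu₂ a b ha hb hab => ?_⟩
    have hu₁ : 0 < u₁ := hu₁
    have hu₂ : 0 < u₂ := hu₂
    simp only [smul_eq_mul]
    have hu : 0 < a * u₁ + b * u₂ := (convex_Ioi (0 : ℝ)) hu₁ hu₂ ha hb hab
    have hsub : ∀ v : ℝ, 0 < v → ∀ u : ℝ, 0 < u →
        (v * u) ^ (1 + β) * u ^ (-β) = v ^ (1 + β) * u := by
      intro v hv u hu
      rw [Real.mul_rpow hv.le hu.le, mul_assoc, ← Real.rpow_add hu]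
      simp
    refine hkle _ _ fun y hy => ?_
    obtain ⟨v, hv, rfl⟩ : ∃ v, 0 < v ∧ y = (v * (a * u₁ + b * u₂)) ^ (1 + β) := by
      refine ⟨y ^ (1 + β)⁻¹ / (a * u₁ + b * u₂), div_pos (Real.rpow_pos_of_pos hy _) hu, ?_⟩
      rw [div_mul_cancel₀ _ hu.ne', ← Real.rpow_mul hy.le, inv_mul_cancel₀ (by positivity),
        Real.rpow_one]
    rw [hsub v hv _ hu]
    have h1 := hle _ (Real.rpow_pos_of_pos (mul_pos hv hu₁) (1 + β)) u₁ hu₁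
    have h2 := hle _ (Real.rpow_pos_of_pos (mul_pos hv hu₂) (1 + β)) u₂ hu₂
    rw [hsub v hv _ hu₁] at h1
    rw [hsub v hv _ hu₂] at h2
    have h3 := hconv.2 (mul_pos hv hu₁) (mul_pos hv hu₂) ha hb hab
    simp only [smul_eq_mul] at h3
    rw [show v * (a * u₁ + b * u₂) = a * (v * u₁) + b * (v * u₂) by ring]
    have h4 := mul_le_mul_of_nonneg_left h1 ha
    have h5 := mul_le_mul_of_nonneg_left h2 hb
    linarith
  · intro s hs u hu
    rcases hs.eq_or_lt with rfl | hs
    · simp only [lt_irrefl, if_false, zero_mul, zero_add]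
      refine le_of_forall_pos_le_add fun ε hε => ?_
      have hp := Real.rpow_pos_of_pos hu (-β)
      have h1 := hle (ε / u ^ (-β)) (div_pos hε hp) u hu
      rw [div_mul_cancel₀ _ hp.ne'] at h1
      have h2 : c ≤ f (ε / u ^ (-β)) := csInf_le hbelow ⟨_, div_pos hε hp, rfl⟩
      linarith
    · simp only [hs, if_true]
      linarith [hle s hs u hu]
  · intro s hs ε hε
    have hu : ∀ τ : ℝ, 0 < τ → ∃ u : ℝ, 0 < u ∧ u ^ (-β) = τ := fun τ hτ =>
      ⟨τ ^ (-β)⁻¹, Real.rpow_pos_of_pos hτ _, by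
        rw [← Real.rpow_mul hτ.le, inv_mul_cancel₀ (by linarith), Real.rpow_one]⟩
    rcases hs.eq_or_lt with rfl | hs
    -- `u ^ (-β)` is chosen above the slope of a supporting line, since that slope may be `0`
    · obtain ⟨_, ⟨y₀, hy₀, rfl⟩, hy₀c⟩ := exists_lt_of_csInf_lt (nonempty_Ioi.image f)
        (show sInf (f '' Ioi 0) < c + ε by linarith)
      have hy₀ : 0 < y₀ := hy₀
      obtain ⟨d, hd0, hd⟩ := hsuper y₀ hy₀
      obtain ⟨u, hu, hud⟩ := hu (d + 1) (by linarith)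
      refine ⟨u, hu, ?_⟩
      simp only [lt_irrefl, if_false, zero_mul, zero_add]
      refine hkle _ _ fun y hy => ?_
      rw [hud]
      have := hd y hy
      nlinarith [mul_nonneg hd0 hy₀.le]
    · obtain ⟨d, hd0, hd⟩ := hsuper s hs
      obtain ⟨u, hu, hud⟩ := hu (d + ε / s) (by positivity)
      refine ⟨u, hu, ?_⟩
      simp only [hs, if_true]
      suffices k u ≤ f s + ε - s * u ^ (-β) by linarith
      refine hkle _ _ fun y hy => ?_
      rw [hud]
      have h1 := hd y hy
      have h2 : s * (ε / s) = ε := by field_simp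
      have h3 : 0 ≤ y * (ε / s) := by positivity
      nlinarith

/-! ### Convex trace functions and Klein's inequality -/

section TraceFunctions

variable {N : Type*} [Fintype N] [DecidableEq N]

lemma re_trace_cfc {S : Matrix N N ℂ} (hS : S.IsHermitian) (φ : ℝ → ℝ) :
    (cfc φ S).trace.re = ∑ i, φ (hS.eigenvalues i) := by
  rw [cfc_eq_eigenvectorUnitary hS, Matrix.trace_mul_comm, ← Matrix.mul_assoc]
  simp [Matrix.trace]

lemma cfc_comp_matrix {S : Matrix N N ℂ} (hS : S.IsHermitian) (φ ψ : ℝ → ℝ) :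
    cfc (fun x => ψ (φ x)) S = cfc ψ (cfc φ S) :=
  cfc_comp' ψ φ S (((Matrix.finite_real_spectrum (A := S)).image φ).continuousOn ψ)
    ((Matrix.finite_real_spectrum (A := S)).continuousOn φ) hS

lemma cfc_mul_matrix (S : Matrix N N ℂ) (φ ψ : ℝ → ℝ) :
    cfc (fun x => φ x * ψ x) S = cfc φ S * cfc ψ S :=
  cfc_mul φ ψ S ((Matrix.finite_real_spectrum (A := S)).continuousOn φ)
    ((Matrix.finite_real_spectrum (A := S)).continuousOn ψ)

lemma posDef_cfc {S : Matrix N N ℂ} (hS : S.IsHermitian) {φ : ℝ → ℝ}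
    (hφ : ∀ i, 0 < φ (hS.eigenvalues i)) : (cfc φ S).PosDef := by
  rw [cfc_eq_eigenvectorUnitary hS]
  refine (Matrix.IsUnit.posDef_star_right_conjugate_iff
    (Unitary.toUnits hS.eigenvectorUnitary).isUnit).2 ?_
  exact Matrix.PosDef.diagonal fun i => by exact_mod_cast hφ i

/-- Klein's inequality in two-variable form: a pointwise inequality between sums of products
passes to traces. -/
lemma klein_inequality {S U : Matrix N N ℂ} (hS : S.IsHermitian) (hU : U.IsHermitian)
    {g φ ψ k : ℝ → ℝ}
    (h : ∀ i j, g (hS.eigenvalues i) ≤ φ (hS.eigenvalues i) * ψ (hU.eigenvalues j) +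
      k (hU.eigenvalues j)) :
    (cfc g S).trace.re ≤ (cfc φ S * cfc ψ U).trace.re + (cfc k U).trace.re := by
  have h1 := re_trace_cfc_mul_cfc hS hU 1 g (fun _ => 1)
  have h2 := re_trace_cfc_mul_cfc hS hU 1 φ ψ
  have h3 := re_trace_cfc_mul_cfc hS hU 1 (fun _ => 1) k
  simp only [cfc_one_eq hS, cfc_one_eq hU, Matrix.conjTranspose_one, Matrix.mul_one,
    Matrix.one_mul] at h1 h2 h3
  rw [h1, h2, h3, ← Finset.sum_add_distrib]
  refine Finset.sum_le_sum fun i _ => ?_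
  rw [← Finset.sum_add_distrib]
  refine Finset.sum_le_sum fun j _ => ?_
  have := mul_le_mul_of_nonneg_right (h i j) (specWeight_nonneg hS hU 1 i j)
  linarith

/-- For convex `k` the trace function `U ↦ Tr k(U)` is convex. -/
lemma trace_cfc_convex {k : ℝ → ℝ} (hk : ConvexOn ℝ (Ioi 0) k) {U₁ U₂ : Matrix N N ℂ}
    (h₁ : U₁.PosDef) (h₂ : U₂.PosDef) {a b : ℝ} (ha : 0 ≤ a) (hb : 0 ≤ b) (hab : a + b = 1) :
    (cfc k (a • U₁ + b • U₂)).trace.re ≤ a * (cfc k U₁).trace.re + b * (cfc k U₂).trace.re := by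
  have hU := posDef_combo h₁ h₂ ha hb hab
  set U := a • U₁ + b • U₂ with hUdef
  -- `d` selects a subgradient of `k`; the supporting line at the spectrum of the average `U`
  -- bounds `Tr k(U₁)` and `Tr k(U₂)` below by expressions affine in `U₁`, `U₂`
  have hd : ∃ d : ℝ → ℝ, ∀ x, 0 < x → ∀ y, 0 < y → k x + d x * (y - x) ≤ k y := by
    have : ∀ x, ∃ d : ℝ, 0 < x → ∀ y, 0 < y → k x + d * (y - x) ≤ k y := fun x => by
      by_cases hx : 0 < x
      · obtain ⟨d, hd⟩ := hk.exists_subgradient_Ioi hx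
        exact ⟨d, fun _ => hd⟩
      · exact ⟨0, fun h => absurd h hx⟩
    choose d hd using this
    exact ⟨d, hd⟩
  obtain ⟨d, hd⟩ := hd
  have key : ∀ {W : Matrix N N ℂ}, W.PosDef → (cfc (fun x => k x - d x * x) U).trace.re ≤
      -(cfc d U * W).trace.re + (cfc k W).trace.re := by
    intro W hW
    have := klein_inequality hU.1 hW.1 (g := fun x => k x - d x * x) (φ := fun x => -d x)
      (ψ := fun y => y) (k := k) fun i j => by
        have := hd _ (hU.eigenvalues_pos i) _ (hW.eigenvalues_pos j)
        linarith
    rwa [cfc_neg, cfc_id_eq hW.1, Matrix.neg_mul, Matrix.trace_neg, Complex.neg_re] at this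
  have hsub : (cfc (fun x => k x - d x * x) U).trace.re =
      (cfc k U).trace.re - (cfc d U * U).trace.re := by
    have h := cfc_mul_matrix U d (fun x => x)
    rw [cfc_id_eq hU.1] at h
    rw [← h, re_trace_cfc hU.1, re_trace_cfc hU.1, re_trace_cfc hU.1, Finset.sum_sub_distrib]
  have hlin : ∀ D : Matrix N N ℂ, (D * U).trace.re =
      a * (D * U₁).trace.re + b * (D * U₂).trace.re := by
    intro D
    simp only [hUdef, Matrix.mul_add, Matrix.mul_smul, Matrix.trace_add, Matrix.trace_smul,
      Complex.add_re, Complex.smul_re, smul_eq_mul]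
  have e₁ := mul_le_mul_of_nonneg_left (key h₁) ha
  have e₂ := mul_le_mul_of_nonneg_left (key h₂) hb
  rw [hsub] at e₁ e₂
  have : (cfc k U).trace.re - (cfc d U * U).trace.re =
      a * ((cfc k U).trace.re - (cfc d U * U).trace.re) +
      b * ((cfc k U).trace.re - (cfc d U * U).trace.re) := by rw [← add_mul, hab, one_mul]
  linarith [hlin (cfc d U)]

/-- Upper bound in the variational principle: the scalar inequality passes to traces. -/
lemma trace_cfc_le_variational {β : ℝ} {f₀ k : ℝ → ℝ}
    (h : ∀ s, 0 ≤ s → ∀ u, 0 < u → f₀ s ≤ s * u ^ (-β) + k u) {S U : Matrix N N ℂ}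
    (hS : S.PosSemidef) (hU : U.PosDef) :
    (cfc f₀ S).trace.re ≤
      (S * cfc (fun x : ℝ => x ^ (-β)) U).trace.re + (cfc k U).trace.re := by
  have := klein_inequality hS.1 hU.1 (g := f₀) (φ := fun x => x) (ψ := fun x => x ^ (-β)) (k := k)
    fun i j => h _ (hS.eigenvalues_nonneg i) _ (hU.eigenvalues_pos j)
  rwa [cfc_id_eq hS.1] at this

/-- The bound of `trace_cfc_le_variational` is nearly attained, by a function `U = u(S)` of `S`. -/
lemma exists_variational_le_trace_cfc {β : ℝ} {f₀ k : ℝ → ℝ}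
    (h : ∀ s, 0 ≤ s → ∀ ε, 0 < ε → ∃ u, 0 < u ∧ s * u ^ (-β) + k u ≤ f₀ s + ε)
    {S : Matrix N N ℂ} (hS : S.PosSemidef) {ε : ℝ} (hε : 0 < ε) :
    ∃ U : Matrix N N ℂ, U.PosDef ∧
      (S * cfc (fun x : ℝ => x ^ (-β)) U).trace.re + (cfc k U).trace.re ≤
        (cfc f₀ S).trace.re + ε := by
  set δ := ε / (Fintype.card N + 1) with hδ
  have hδ0 : 0 < δ := by positivity
  have hu : ∀ s, ∃ u, 0 ≤ s → 0 < u ∧ s * u ^ (-β) + k u ≤ f₀ s + δ := fun s => by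
    by_cases hs : 0 ≤ s
    · obtain ⟨u, hu⟩ := h s hs δ hδ0
      exact ⟨u, fun _ => hu⟩
    · exact ⟨0, fun h => absurd h hs⟩
  choose u hu using hu
  refine ⟨cfc u S, posDef_cfc hS.1 fun i => (hu _ (hS.eigenvalues_nonneg i)).1, ?_⟩
  have h1 : S * cfc (fun x : ℝ => x ^ (-β)) (cfc u S) = cfc (fun x => x * u x ^ (-β)) S := by
    rw [cfc_mul_matrix S (fun x => x) (fun x => u x ^ (-β)), cfc_id_eq hS.1,
      cfc_comp_matrix hS.1 u (fun x => x ^ (-β))]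
  rw [h1, ← cfc_comp_matrix hS.1 u k, re_trace_cfc hS.1, re_trace_cfc hS.1, re_trace_cfc hS.1,
    ← Finset.sum_add_distrib]
  calc _ ≤ ∑ i, (f₀ (hS.1.eigenvalues i) + δ) :=
        Finset.sum_le_sum fun i _ => (hu _ (hS.eigenvalues_nonneg i)).2
    _ = ∑ i, f₀ (hS.1.eigenvalues i) + Fintype.card N * δ := by
        rw [Finset.sum_add_distrib]; simp
    _ ≤ _ := by
        have : Fintype.card N * δ ≤ ε := by
          rw [hδ, mul_div_assoc', div_le_iff₀ (by positivity)]
          nlinarith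
        linarith

end TraceFunctions

/-! ### Spectra of `MᴴM` and `MMᴴ` -/

lemma re_trace_cfc_eq_sum_roots {N : Type*} [Fintype N] [DecidableEq N] {S : Matrix N N ℂ}
    (hS : S.IsHermitian) (φ : ℝ → ℝ) :
    (cfc φ S).trace.re = (S.charpoly.roots.map fun z => φ z.re).sum := by
  rw [re_trace_cfc hS, hS.roots_charpoly_eq_eigenvalues, Multiset.map_map]
  simp

/-- `MᴴM` and `MMᴴ` have the same nonzero spectrum with multiplicities; the sizes account for the
eigenvalue `0`. -/
lemma re_trace_cfc_conjTranspose_mul_self {N L : Type*} [Fintype N] [DecidableEq N] [Fintype L]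
    [DecidableEq L] (M : Matrix N L ℂ) (φ : ℝ → ℝ) :
    (cfc φ (M.conjTranspose * M)).trace.re = (cfc φ (M * M.conjTranspose)).trace.re +
      ((Fintype.card L : ℝ) - Fintype.card N) * φ 0 := by
  rw [re_trace_cfc_eq_sum_roots (Matrix.isHermitian_conjTranspose_mul_self M),
    re_trace_cfc_eq_sum_roots (Matrix.isHermitian_mul_conjTranspose_self M)]
  have h := congrArg (fun q => (q.roots.map fun z : ℂ => φ z.re).sum)
    (Matrix.charpoly_mul_comm' M.conjTranspose M)
  rw [Polynomial.roots_mul (mul_ne_zero (pow_ne_zero _ Polynomial.X_ne_zero)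
      (Matrix.charpoly_monic _).ne_zero),
    Polynomial.roots_mul (mul_ne_zero (pow_ne_zero _ Polynomial.X_ne_zero)
      (Matrix.charpoly_monic _).ne_zero)] at h
  simp only [Polynomial.roots_X_pow, Multiset.map_add, Multiset.sum_add, Multiset.map_nsmul,
    Multiset.sum_nsmul, Multiset.map_singleton, Multiset.sum_singleton, Complex.zero_re,
    nsmul_eq_mul] at h
  linarith

/-! ### Kraus decompositions -/

/-- A positive element of a C⋆-algebra factors as `star b * b`; stated for an abstract algebra, which
spares instance unification through the entries of `CStarMatrix`. -/
lemma exists_eq_star_mul_self_of_nonneg {A : Type*} [NonUnitalCStarAlgebra A] [PartialOrder A]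
    [StarOrderedRing A] {a : A} (ha : 0 ≤ a) : ∃ b : A, a = star b * b :=
  CStarAlgebra.nonneg_iff_eq_star_mul_self.mp ha

/-- **Choi's theorem**: a completely positive map between matrix algebras has a Kraus
decomposition. -/
theorem CompletelyPositiveMap.exists_kraus {n l : ℕ}
    (Φ : Matrix (Fin n) (Fin n) ℂ →CP Matrix (Fin l) (Fin l) ℂ) :
    ∃ V : Fin n × Fin l → Matrix (Fin n) (Fin l) ℂ,
      ∀ A, Φ.toLinearMap A = ∑ κ, (V κ).conjTranspose * A * V κ := by
  rcases isEmpty_or_nonempty (Fin n) with hn | ⟨⟨k₀⟩⟩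
  · refine ⟨fun _ => 0, fun A => ?_⟩
    rw [Subsingleton.elim A 0]
    simp
  set E : CStarMatrix (Fin n) (Fin n) (Matrix (Fin n) (Fin n) ℂ) :=
    CStarMatrix.ofMatrix (Matrix.of fun i j => Matrix.single i j 1) with hE
  set F : CStarMatrix (Fin n) (Fin n) (Matrix (Fin n) (Fin n) ℂ) :=
    CStarMatrix.ofMatrix (Matrix.of fun k j => if k = k₀ then Matrix.single k₀ j 1 else 0) with hF
  have hEF : E = star F * F := by
    ext1 i j
    rw [CStarMatrix.mul_apply, Finset.sum_eq_single k₀]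
    · simp [hE, hF, CStarMatrix.star_apply, Matrix.star_eq_conjTranspose]
    · intro k _ hk
      simp [hF, hk]
    · simp
  have hE0 : 0 ≤ E := hEF ▸ star_mul_self_nonneg F
  obtain ⟨M, hM⟩ := exists_eq_star_mul_self_of_nonneg
    (Φ.map_cstarMatrix_nonneg' n E hE0)
  have hij : ∀ i j, Φ.toLinearMap (Matrix.single i j 1) =
      ∑ k, (M k i).conjTranspose * M k j := by
    intro i j
    have := congrArg (fun T : CStarMatrix (Fin n) (Fin n) (Matrix (Fin l) (Fin l) ℂ) => T i j) hM
    simpa [CStarMatrix.mul_apply, CStarMatrix.star_apply, Matrix.star_eq_conjTranspose, hE]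
      using this
  refine ⟨fun κ => Matrix.of fun j b => M κ.1 j κ.2 b, fun A => ?_⟩
  conv_lhs => rw [Matrix.matrix_eq_sum_single A]
  simp only [map_sum]
  have hs : ∀ i j, Φ.toLinearMap (Matrix.single i j (A i j)) =
      A i j • ∑ k, (M k i).conjTranspose * M k j := by
    intro i j
    rw [← hij, ← map_smul, Matrix.smul_single, smul_eq_mul, mul_one]
  simp only [hs]
  ext a b
  simp only [Matrix.sum_apply, Matrix.smul_apply, Matrix.mul_apply, Matrix.conjTranspose_apply,
    Matrix.of_apply, smul_eq_mul, Finset.mul_sum, Finset.sum_mul, Fintype.sum_prod_type]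
  -- both sides are sums over `i`, `j`, `k` and the row index `r` of the blocks
  calc _ = ∑ i, ∑ k, ∑ r, ∑ j, A i j * (star (M k i r a) * M k j r b) := by
        refine Finset.sum_congr rfl fun i _ => ?_
        rw [Finset.sum_comm]
        refine Finset.sum_congr rfl fun k _ => ?_
        rw [Finset.sum_comm]
    _ = ∑ k, ∑ r, ∑ i, ∑ j, A i j * (star (M k i r a) * M k j r b) := by
        rw [Finset.sum_comm]
        refine Finset.sum_congr rfl fun k _ => ?_
        rw [Finset.sum_comm]
    _ = _ := by
        refine Finset.sum_congr rfl fun k _ => Finset.sum_congr rfl fun r _ => ?_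
        rw [Finset.sum_comm]
        refine Finset.sum_congr rfl fun j _ => Finset.sum_congr rfl fun i _ => ?_
        ring

/-- The blocks `B Wκ` stacked into one tall matrix `Y`, so that `Yᴴ Y = ∑ Wκᴴ Bᴴ B Wκ`. -/
def stackedMul {ι m L : Type*} [Fintype m] (W : ι → Matrix m L ℂ) (B : Matrix m m ℂ) :
    Matrix (ι × m) L ℂ :=
  Matrix.of fun q b => (B * W q.1) q.2 b

lemma stackedMul_conjTranspose_mul_self {ι m L : Type*} [Fintype ι] [Fintype m]
    (W : ι → Matrix m L ℂ) (B : Matrix m m ℂ) :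
    (stackedMul W B).conjTranspose * stackedMul W B =
      ∑ κ, (W κ).conjTranspose * (B.conjTranspose * B) * W κ := by
  have : ∀ κ, (W κ).conjTranspose * (B.conjTranspose * B) * W κ =
      (B * W κ).conjTranspose * (B * W κ) := fun κ => by
    simp only [Matrix.conjTranspose_mul, Matrix.mul_assoc]
  ext a b
  simp only [this, Matrix.sum_apply]
  rw [Matrix.mul_apply, Fintype.sum_prod_type]
  rfl

lemma stackedMul_combo {ι m L : Type*} [Fintype m] (W : ι → Matrix m L ℂ) (a b : ℝ)
    (B₁ B₂ : Matrix m m ℂ) :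
    stackedMul W (a • B₁ + b • B₂) = a • stackedMul W B₁ + b • stackedMul W B₂ := by
  ext q c
  simp [stackedMul, Matrix.add_mul]

/-! ### Real powers of positive definite matrices -/

lemma rpow_eq_cfc_matrix {n : ℕ} {A : Matrix (Fin n) (Fin n) ℂ} (hA : A.PosDef) (p : ℝ) :
    A ^ p = cfc (fun x : ℝ => x ^ p) A :=
  CFC.rpow_eq_cfc_real hA.posSemidef.nonneg

lemma posDef_rpow {n : ℕ} {A : Matrix (Fin n) (Fin n) ℂ} (hA : A.PosDef) (p : ℝ) :
    (A ^ p).PosDef := by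
  rw [rpow_eq_cfc_matrix hA]
  exact posDef_cfc hA.1 fun i => Real.rpow_pos_of_pos (hA.eigenvalues_pos i) p

lemma rpow_half_mul_self {n : ℕ} {A : Matrix (Fin n) (Fin n) ℂ} (hA : A.PosDef) :
    A ^ (1 / 2 : ℝ) * A ^ (1 / 2 : ℝ) = A := by
  rw [rpow_eq_cfc_matrix hA, ← cfc_mul_matrix]
  conv_rhs => rw [← cfc_id_eq hA.1]
  rw [cfc_eq_eigenvectorUnitary hA.1, cfc_eq_eigenvectorUnitary hA.1]
  congr 3
  funext i
  rw [← Real.rpow_add (hA.eigenvalues_pos i)]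
  norm_num

lemma rpow_two_eq_mul_self {n : ℕ} {A : Matrix (Fin n) (Fin n) ℂ} (hA : A.PosDef) :
    A ^ (2 : ℝ) = A * A := by
  rw [rpow_eq_cfc_matrix hA]
  have : (fun x : ℝ => x ^ (2 : ℝ)) = fun x => x * x := by
    funext x
    rw [Real.rpow_two, sq]
  rw [this, cfc_mul_matrix, cfc_id_eq hA.1]

lemma posDef_rpow_half_conj {n : ℕ} {P Q : Matrix (Fin n) (Fin n) ℂ} (hP : P.PosDef)
    (hQ : Q.PosDef) : (P ^ (1 / 2 : ℝ) * Q * P ^ (1 / 2 : ℝ)).PosDef := by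
  have hR := posDef_rpow hP (1 / 2)
  have := (Matrix.IsUnit.posDef_star_left_conjugate_iff hR.isUnit (x := Q)).2 hQ
  rwa [Matrix.star_eq_conjTranspose, hR.1.eq] at this

/-- The compressed operator `Y P Yᴴ` has, up to zeros, the same eigenvalues as
`P^{1/2} Yᴴ Y P^{1/2}`. -/
lemma re_trace_cfc_rpow_half_conj {N : Type*} [Fintype N] [DecidableEq N] {l : ℕ}
    {P : Matrix (Fin l) (Fin l) ℂ} (hP : P.PosDef) {Y : Matrix N (Fin l) ℂ}
    (hY : (Y.conjTranspose * Y).PosDef) {f f₀ : ℝ → ℝ} (hf : ∀ x, 0 < x → f₀ x = f x) :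
    (cfc f (P ^ (1 / 2 : ℝ) * (Y.conjTranspose * Y) * P ^ (1 / 2 : ℝ))).trace.re =
      (cfc f₀ (Y * P * Y.conjTranspose)).trace.re + ((l : ℝ) - Fintype.card N) * f₀ 0 := by
  have hX := posDef_rpow_half_conj hP hY
  have hR := (posDef_rpow hP (1 / 2)).1.eq
  have h1 : P ^ (1 / 2 : ℝ) * (Y.conjTranspose * Y) * P ^ (1 / 2 : ℝ) =
      (Y * P ^ (1 / 2 : ℝ)).conjTranspose * (Y * P ^ (1 / 2 : ℝ)) := by
    rw [Matrix.conjTranspose_mul, hR]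
    simp only [Matrix.mul_assoc]
  have h2 : Y * P * Y.conjTranspose =
      (Y * P ^ (1 / 2 : ℝ)) * (Y * P ^ (1 / 2 : ℝ)).conjTranspose := by
    rw [Matrix.conjTranspose_mul, hR]
    conv_lhs => rw [← rpow_half_mul_self hP]
    simp only [Matrix.mul_assoc]
  have h3 : (cfc f (P ^ (1 / 2 : ℝ) * (Y.conjTranspose * Y) * P ^ (1 / 2 : ℝ))).trace.re =
      (cfc f₀ (P ^ (1 / 2 : ℝ) * (Y.conjTranspose * Y) * P ^ (1 / 2 : ℝ))).trace.re := by
    rw [re_trace_cfc hX.1, re_trace_cfc hX.1]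
    exact Finset.sum_congr rfl fun i _ => (hf _ (hX.eigenvalues_pos i)).symm
  rw [h3, h1, h2, re_trace_cfc_conjTranspose_mul_self, Fintype.card_fin]

/-! ### Joint convexity -/

/-- The objective of the variational principle is jointly convex in `(A, Y, U)`, by Lieb's theorem
applied to each Kraus operator and convexity of `U ↦ Tr k(U)`. -/
lemma variational_objective_convex {ι n N L : Type*} [Fintype ι] [Fintype n] [DecidableEq n]
    [Fintype N] [DecidableEq N] [Fintype L] {β : ℝ} (hβ₀ : 0 < β) (hβ₁ : β ≤ 1) {k : ℝ → ℝ}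
    (hk : ConvexOn ℝ (Ioi 0) k) (V : ι → Matrix n L ℂ) {A₁ A₂ : Matrix n n ℂ}
    {U₁ U₂ : Matrix N N ℂ} (Y₁ Y₂ : Matrix N L ℂ) (hA₁ : A₁.PosDef) (hA₂ : A₂.PosDef)
    (hU₁ : U₁.PosDef) (hU₂ : U₂.PosDef) {a b : ℝ} (ha : 0 ≤ a) (hb : 0 ≤ b) (hab : a + b = 1) :
    let T : Matrix n n ℂ → Matrix N L ℂ → Matrix N N ℂ → ℝ := fun A Y U =>
      (Y * (∑ κ, (V κ).conjTranspose * cfc (fun x : ℝ => x ^ (β - 1)) A * V κ) *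
        Y.conjTranspose * cfc (fun x : ℝ => x ^ (-β)) U).trace.re + (cfc k U).trace.re
    T (a • A₁ + b • A₂) (a • Y₁ + b • Y₂) (a • U₁ + b • U₂) ≤
      a * T A₁ Y₁ U₁ + b * T A₂ Y₂ U₂ := by
  intro T
  have hT : ∀ A Y U, T A Y U = ∑ κ, ((V κ * Y.conjTranspose).conjTranspose *
      cfc (fun x : ℝ => x ^ (β - 1)) A * (V κ * Y.conjTranspose) *
      cfc (fun x : ℝ => x ^ (-β)) U).trace.re + (cfc k U).trace.re := by
    intro A Y U
    simp only [T, Matrix.mul_sum, Matrix.sum_mul, Matrix.trace_sum, Complex.re_sum,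
      Matrix.conjTranspose_mul, Matrix.conjTranspose_conjTranspose, Matrix.mul_assoc]
  rw [hT, hT, hT, mul_add, mul_add, Finset.mul_sum, Finset.mul_sum, add_add_add_comm,
    ← Finset.sum_add_distrib]
  refine add_le_add (Finset.sum_le_sum fun κ _ => ?_) (trace_cfc_convex hk hU₁ hU₂ ha hb hab)
  have hK : V κ * (a • Y₁ + b • Y₂).conjTranspose =
      a • (V κ * Y₁.conjTranspose) + b • (V κ * Y₂.conjTranspose) := by
    simp [Matrix.conjTranspose_add, Matrix.conjTranspose_smul, Matrix.mul_add]
  rw [hK]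
  exact lieb_joint_convex hβ₀ hβ₁ _ _ hA₁ hA₂ hU₁ hU₂ ha hb hab

theorem theorem5p6 {n m l : ℕ}
    (Φ : Matrix (Fin n) (Fin n) ℂ →CP Matrix (Fin l) (Fin l) ℂ)
    (Ψ : Matrix (Fin m) (Fin m) ℂ →CP Matrix (Fin l) (Fin l) ℂ)
    (hΦ : StrictlyPositiveMap Φ.toLinearMap) (hΨ : StrictlyPositiveMap Ψ.toLinearMap)
    (p : ℝ) (hp₁ : -1 ≤ p) (hp₀ : p ≤ 0)
    (f : ℝ → ℝ) (hmono : MonotoneOn f (Ioi 0)) (hconc : ConcaveOn ℝ (Ioi 0) f)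
    (hlim : Tendsto (fun x => f x / x) atTop (𝓝 0))
    (hconv : ConvexOn ℝ (Ioi 0) (fun x => f (x ^ (2 + p)))) :
    ConvexOn ℝ ({A : Matrix (Fin n) (Fin n) ℂ | A.PosDef} ×ˢ
        {B : Matrix (Fin m) (Fin m) ℂ | B.PosDef})
      (fun AB => liebTrace f p 2 Φ.toLinearMap Ψ.toLinearMap AB.1 AB.2) := by
  have hset : Convex ℝ ({A : Matrix (Fin n) (Fin n) ℂ | A.PosDef} ×ˢ
      {B : Matrix (Fin m) (Fin m) ℂ | B.PosDef}) := by
    refine Convex.prod ?_ ?_ <;>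
      exact fun _ h₁ _ h₂ _ _ ha hb hab => posDef_combo h₁ h₂ ha hb hab
  rcases hp₁.eq_or_lt with rfl | hp₁
  · -- for `p = -1` the function `f` is both convex and sublinear, hence constant
    have hconv' : ConvexOn ℝ (Ioi 0) f := by
      have h21 : (2 : ℝ) + -1 = 1 := by norm_num
      simpa only [h21, Real.rpow_one] using hconv
    have hconst : ∀ AB ∈ {A : Matrix (Fin n) (Fin n) ℂ | A.PosDef} ×ˢ
        {B : Matrix (Fin m) (Fin m) ℂ | B.PosDef},
        liebTrace f (-1) 2 Φ.toLinearMap Ψ.toLinearMap AB.1 AB.2 = l * f 1 := by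
      rintro ⟨A, B⟩ ⟨hA, hB⟩
      have hX := posDef_rpow_half_conj (hΦ _ (posDef_rpow hA (-1))) (hΨ _ (posDef_rpow hB 2))
      rw [liebTrace, re_trace_cfc hX.1]
      rw [Finset.sum_congr rfl fun i _ => hconv'.eq_of_monotoneOn_of_tendsto_div hmono hlim
        (hX.eigenvalues_pos i) one_pos]
      simp
    exact (convexOn_const ((l : ℝ) * f 1) hset).congr fun AB h => (hconst AB h).symm
  obtain ⟨β, rfl⟩ : ∃ β, p = β - 1 := ⟨p + 1, by ring⟩
  have hβ₀ : 0 < β := by linarith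
  have hβ₁ : β ≤ 1 := by linarith
  rw [show 2 + (β - 1) = 1 + β by ring] at hconv
  obtain ⟨f₀, k, hf₀, hk, hle, happrox⟩ := exists_convex_variational hβ₀ hmono hconc hlim hconv
  obtain ⟨V, hV⟩ := Φ.exists_kraus
  obtain ⟨W, hW⟩ := Ψ.exists_kraus
  set c : ℝ := ((l : ℝ) - Fintype.card ((Fin m × Fin l) × Fin m)) * f₀ 0
  set S : Matrix (Fin n) (Fin n) ℂ → Matrix (Fin m) (Fin m) ℂ →
      Matrix ((Fin m × Fin l) × Fin m) ((Fin m × Fin l) × Fin m) ℂ := fun A B =>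
    stackedMul W B * (∑ κ, (V κ).conjTranspose * cfc (fun x : ℝ => x ^ (β - 1)) A * V κ) *
      (stackedMul W B).conjTranspose with hS
  have hΦS : ∀ {A : Matrix (Fin n) (Fin n) ℂ}, A.PosDef → Φ.toLinearMap (A ^ (β - 1)) =
      ∑ κ, (V κ).conjTranspose * cfc (fun x : ℝ => x ^ (β - 1)) A * V κ := fun hA => by
    rw [hV, rpow_eq_cfc_matrix hA]
  have htrace : ∀ {A : Matrix (Fin n) (Fin n) ℂ} {B : Matrix (Fin m) (Fin m) ℂ}, A.PosDef →
      B.PosDef → (S A B).PosSemidef ∧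
      liebTrace f (β - 1) 2 Φ.toLinearMap Ψ.toLinearMap A B = (cfc f₀ (S A B)).trace.re + c := by
    intro A B hA hB
    have hP := hΦ _ (posDef_rpow hA (β - 1))
    have hΨB : Ψ.toLinearMap (B ^ (2 : ℝ)) =
        (stackedMul W B).conjTranspose * stackedMul W B := by
      rw [stackedMul_conjTranspose_mul_self, hB.1.eq, rpow_two_eq_mul_self hB, hW]
    have hQ := hΨ _ (posDef_rpow hB 2)
    rw [hΨB] at hQ
    rw [hS]
    simp only
    rw [← hΦS hA]
    refine ⟨hP.posSemidef.mul_mul_conjTranspose_same _, ?_⟩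
    rw [liebTrace, hΨB]
    exact re_trace_cfc_rpow_half_conj hP hQ hf₀
  refine ⟨hset, ?_⟩
  rintro ⟨A₁, B₁⟩ ⟨hA₁, hB₁⟩ ⟨A₂, B₂⟩ ⟨hA₂, hB₂⟩ a b ha hb hab
  obtain ⟨hS₁, e₁⟩ := htrace hA₁ hB₁
  obtain ⟨hS₂, e₂⟩ := htrace hA₂ hB₂
  obtain ⟨hS₀, e₀⟩ := htrace (posDef_combo hA₁ hA₂ ha hb hab) (posDef_combo hB₁ hB₂ ha hb hab)
  simp only [Prod.smul_mk, Prod.mk_add_mk, smul_eq_mul] at *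
  rw [e₀, e₁, e₂]
  refine le_of_forall_pos_le_add fun ε hε => ?_
  obtain ⟨U₁, hU₁, h₁⟩ := exists_variational_le_trace_cfc happrox hS₁ hε
  obtain ⟨U₂, hU₂, h₂⟩ := exists_variational_le_trace_cfc happrox hS₂ hε
  have h₀ := trace_cfc_le_variational hle hS₀ (posDef_combo hU₁ hU₂ ha hb hab)
  have h := variational_objective_convex hβ₀ hβ₁ hk V (stackedMul W B₁) (stackedMul W B₂)
    hA₁ hA₂ hU₁ hU₂ ha hb hab
  simp only [← stackedMul_combo] at h
  have h₁' := mul_le_mul_of_nonneg_left h₁ ha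
  have h₂' := mul_le_mul_of_nonneg_left h₂ hb
  have hc : a * c + b * c = c := by rw [← add_mul, hab, one_mul]
  have hε' : a * ε + b * ε = ε := by rw [← add_mul, hab, one_mul]
  simp only [hS] at h₀ h₁' h₂' ⊢
  linarith
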